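/- Let $\kappa$ be a field and $G$ a group. A map $\Gamma:G\to R$ into a unital $\kappa$-algebra $R$ is a partial projective representation with factor set $\sigma:G\times G\to\kappa$ if for all $g,h\in G$: (i) $\sigma(g,h)=0$ implies $\Gamma(g^{-1})\Gamma(gh)=0$ and $\Gamma(gh)\Gamma(h^{-1})=0$; (ii) $\Gamma(g)\Gamma(h)=0$ implies $\sigma(g,h)=0$; (iii) $\Gamma(1)=1$; (iv) $\Gamma(g^{-1})\Gamma(g)\Gamma(h)=\sigma(g,h)\Gamma(g^{-1})\Gamma(gh)$; (v) $\Gamma(g)\Gamma(h)\Gamma(h^{-1})=\sigma(g,h)\Gamma(gh)\Gamma(h^{-1})$. Let $\sigma$ be a factor set of $G$, i.e. the factor set of some partial projective representation. The twisted partial group algebra $\kappa_{par}^{\sigma}G$ is the unital $\kappa$-algebra generated by symbols $[g]$ $(g\in G)$ subject to relations (i), (iii), (iv), (v) with $[\,\cdot\,]$ in place of $\Gamma$. Put $e_g=\sigma(g,g^{-1})^{-1}[g][g^{-1}]$ if $\sigma(g,g^{-1})\neq0$ and $e_g=0$ otherwise. These are commuting idempotents; let $B^\sigma$ be the (commutative)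 subalgebra they generate. For $g\in G$ and $w\in B^\sigma$ let $\theta_g(w)=\sigma(g^{-1},g)^{-1}[g]w[g^{-1}]$ if $\sigma(g,g^{-1})\ne0$ and $\theta_g(w)=0$ otherwise, and let $\Theta_g(w)=\theta_g(e_{g^{-1}}w)\in B^\sigma$. The spectral partial action $\hat\theta$ of $G$ on $\operatorname{Spec}B^\sigma$ (prime spectrum, Zariski topology) consists of the open sets $\hat D_g=\{\mathfrak p: e_g\notin\mathfrak p\}$ and the homeomorphisms $\hat\theta_g:\hat D_{g^{-1}}\to\hat D_g$, $\hat\theta_g(\mathfrak p)=\Theta_{g^{-1}}^{-1}(\mathfrak p)$ (so that $\ker f\mapsto\ker(f\circ\Theta_{g^{-1}})$ for algebra homomorphisms $f:B^\sigma\to\kappa$ with $f(e_{g^{-1}})=1$). It is called topologically free if for every $g\neq1$ the set $\{\mathfrak p\in\hat D_{g^{-1}}:\hat\theta_g(\mathfrak p)=\mathfrak p\}$ has empty interior in $\operatorname{Spec}B^\sigma$. Corollary. If $\hat\theta$ is topologically free, then $B^\sigma$ is a maximal commutative subalgebra of $\kappa_{par}^{\sigma}G$, and $\mathcal I\cap B^\sigma\neq0$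 for every nonzero two-sided ideal $\mathcal I$ of $\kappa_{par}^{\sigma}G$. -/

import Mathlib

universe u v w

/-- `Γ : G → R` is a partial projective representation of the group `G` in the unital
`κ`-algebra `R` with factor set `σ`. -/
structure IsPartialProjectiveRep {κ : Type u} {G : Type v} {R : Type w} [Field κ] [Group G]
    [Ring R] [Algebra κ R] (σ : G → G → κ) (Γ : G → R) : Prop where
  zero_left : ∀ g h, σ g h = 0 → Γ g⁻¹ * Γ (g * h) = 0
  zero_right : ∀ g h, σ g h = 0 → Γ (g * h) * Γ h⁻¹ = 0
  eq_zero : ∀ g h, Γ g * Γ h = 0 → σ g h = 0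
  map_one : Γ 1 = 1
  mul_left : ∀ g h, Γ g⁻¹ * Γ g * Γ h = σ g h • (Γ g⁻¹ * Γ (g * h))
  mul_right : ∀ g h, Γ g * Γ h * Γ h⁻¹ = σ g h • (Γ (g * h) * Γ h⁻¹)

/-- `σ` is a factor set of `G` over `κ` (an element of `pm(G)`): the factor set of some partial
projective representation of `G` in some unital `κ`-algebra. -/
def IsFactorSet {κ : Type u} {G : Type v} [Field κ] [Group G] (σ : G → G → κ) : Prop :=
  ∃ (R : Type w) (_ : Ring R) (_ : Algebra κ R) (Γ : G → R), IsPartialProjectiveRep σ Γ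

namespace TwistedPartial

variable {κ : Type u} {G : Type v} [Field κ] [Group G]

/-- The defining relations of the twisted partial group algebra on the free unital algebra over
the symbols `[g]`. The last one says that `[1]` is the identity. -/
inductive Rel (σ : G → G → κ) : FreeAlgebra κ G → FreeAlgebra κ G → Prop
  | zero_left (g h : G) (H : σ g h = 0) :
      Rel σ (FreeAlgebra.ι κ g⁻¹ * FreeAlgebra.ι κ (g * h)) 0
  | zero_right (g h : G) (H : σ g h = 0) :
      Rel σ (FreeAlgebra.ι κ (g * h) * FreeAlgebra.ι κ h⁻¹) 0
  | mul_left (g h : G) :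
      Rel σ (FreeAlgebra.ι κ g⁻¹ * FreeAlgebra.ι κ g * FreeAlgebra.ι κ h)
        (σ g h • (FreeAlgebra.ι κ g⁻¹ * FreeAlgebra.ι κ (g * h)))
  | mul_right (g h : G) :
      Rel σ (FreeAlgebra.ι κ g * FreeAlgebra.ι κ h * FreeAlgebra.ι κ h⁻¹)
        (σ g h • (FreeAlgebra.ι κ (g * h) * FreeAlgebra.ι κ h⁻¹))
  | map_one : Rel σ (FreeAlgebra.ι κ 1) 1

/-- The twisted partial group algebra `κ_par^σ G`. -/
abbrev Alg (σ : G → G → κ) : Type (max u v) := RingQuot (Rel σ)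

/-- The canonical generator `[g]^σ`. -/
def of (σ : G → G → κ) (g : G) : Alg σ :=
  RingQuot.mkAlgHom κ (Rel σ) (FreeAlgebra.ι κ g)

/-- `e_g^σ = σ(g,g⁻¹)⁻¹ [g][g⁻¹]` if `σ(g,g⁻¹) ≠ 0`, and `0` otherwise (recall that `0⁻¹ = 0`). -/
def e (σ : G → G → κ) (g : G) : Alg σ := (σ g g⁻¹)⁻¹ • (of σ g * of σ g⁻¹)

/-- The subalgebra `B^σ` of `κ_par^σ G` generated by the `e_g^σ`. -/
def B (σ : G → G → κ) : Subalgebra κ (Alg σ) := Algebra.adjoin κ (Set.range (e σ))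

section Basic

variable (σ : G → G → κ)

lemma of_zero_left {g h : G} (H : σ g h = 0) : of σ g⁻¹ * of σ (g * h) = 0 := by
  simpa [of] using RingQuot.mkAlgHom_rel κ (Rel.zero_left (σ := σ) g h H)

lemma of_zero_right {g h : G} (H : σ g h = 0) : of σ (g * h) * of σ h⁻¹ = 0 := by
  simpa [of] using RingQuot.mkAlgHom_rel κ (Rel.zero_right (σ := σ) g h H)

lemma of_mul_left (g h : G) :
    of σ g⁻¹ * of σ g * of σ h = σ g h • (of σ g⁻¹ * of σ (g * h)) := by
  simpa [of] using RingQuot.mkAlgHom_rel κ (Rel.mul_left (σ := σ) g h)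

lemma of_mul_right (g h : G) :
    of σ g * of σ h * of σ h⁻¹ = σ g h • (of σ (g * h) * of σ h⁻¹) := by
  simpa [of] using RingQuot.mkAlgHom_rel κ (Rel.mul_right (σ := σ) g h)

lemma of_one : of σ 1 = 1 := by
  simpa [of] using RingQuot.mkAlgHom_rel κ (Rel.map_one (σ := σ))

lemma of_eq_zero {g : G} (H : σ g g⁻¹ = 0) : of σ g = 0 := by
  simpa [of_one] using of_zero_right σ H

lemma of_inv_eq_zero {g : G} (H : σ g g⁻¹ = 0) : of σ g⁻¹ = 0 := by
  simpa [of_one] using of_zero_left σ H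

lemma e_mul_of (g : G) : e σ g * of σ g = of σ g := by
  by_cases H : σ g g⁻¹ = 0
  · simp [of_eq_zero σ H]
  · have h1 := of_mul_right σ g g⁻¹
    simp only [inv_inv, mul_inv_cancel, of_one, one_mul] at h1
    rw [e, smul_mul_assoc, h1, smul_smul, inv_mul_cancel₀ H, one_smul]

lemma of_inv_mul_e (g : G) : of σ g⁻¹ * e σ g = of σ g⁻¹ := by
  by_cases H : σ g g⁻¹ = 0
  · simp [of_inv_eq_zero σ H]
  · have h1 := of_mul_left σ g g⁻¹
    simp only [mul_inv_cancel, of_one, mul_one] at h1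
    rw [e, mul_smul_comm, ← mul_assoc, h1, smul_smul, inv_mul_cancel₀ H, one_smul]

lemma of_mul_e_inv (g : G) : of σ g * e σ g⁻¹ = of σ g := by
  simpa using of_inv_mul_e σ g⁻¹

lemma e_one : e σ 1 = 1 := by
  have h := e_mul_of σ 1
  rwa [of_one, mul_one] at h

lemma of_mul_e (g h : G) : of σ g * e σ h = e σ (g * h) * of σ g := by
  set Y := of σ (g * h) * of σ h⁻¹ with hY
  obtain ⟨a, ha⟩ : ∃ a : κ, of σ g * e σ h = a • Y :=
    ⟨(σ h h⁻¹)⁻¹ * σ g h, by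
      rw [e, mul_smul_comm, ← mul_assoc, of_mul_right, smul_smul]⟩
  obtain ⟨b, hb⟩ : ∃ b : κ, e σ (g * h) * of σ g = b • Y := by
    refine ⟨(σ (g * h) (g * h)⁻¹)⁻¹ * σ (g * h)⁻¹ g, ?_⟩
    have h1 := of_mul_left σ (g * h)⁻¹ g
    have h2 : (g * h)⁻¹ * g = h⁻¹ := by group
    rw [inv_inv, h2] at h1
    rw [e, smul_mul_assoc, h1, smul_smul]
  have h1 : e σ (g * h) * Y = Y := by rw [hY, ← mul_assoc, e_mul_of]
  have h2 : Y * e σ h = Y := by rw [hY, mul_assoc, of_inv_mul_e]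
  calc of σ g * e σ h = e σ (g * h) * (of σ g * e σ h) := by rw [ha, mul_smul_comm, h1]
    _ = (e σ (g * h) * of σ g) * e σ h := by rw [mul_assoc]
    _ = e σ (g * h) * of σ g := by rw [hb, smul_mul_assoc, h2]

lemma e_comm (g h : G) : e σ g * e σ h = e σ h * e σ g := by
  have h1 : of σ g * of σ g⁻¹ * e σ h = e σ h * (of σ g * of σ g⁻¹) := by
    rw [mul_assoc, of_mul_e, ← mul_assoc, of_mul_e, mul_inv_cancel_left, mul_assoc]
  rw [show e σ g = (σ g g⁻¹)⁻¹ • (of σ g * of σ g⁻¹) from rfl, smul_mul_assoc, h1,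
    mul_smul_comm]

lemma e_mem (g : G) : e σ g ∈ B σ := Algebra.subset_adjoin ⟨g, rfl⟩

lemma B_comm {x y : Alg σ} (hx : x ∈ B σ) (hy : y ∈ B σ) : x * y = y * x := by
  have := Algebra.adjoin_le_centralizer_centralizer κ (Set.range (e σ)) hx
  refine (Subalgebra.mem_centralizer_iff κ).1 this y ?_ |>.symm
  have hle : B σ ≤ Subalgebra.centralizer κ (Set.range (e σ)) :=
    Algebra.adjoin_le (by
      rintro _ ⟨g, rfl⟩
      refine (Subalgebra.mem_centralizer_iff κ).2 ?_
      rintro _ ⟨h, rfl⟩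
      exact e_comm σ h g)
  exact hle hy

instance : CommRing (B σ) :=
  { (inferInstance : Ring (B σ)) with
    mul_comm := fun x y => Subtype.ext (B_comm σ x.2 y.2) }

/-- `e_g^σ` as an element of `B^σ`. -/
def eB (g : G) : B σ := ⟨e σ g, e_mem σ g⟩

lemma of_mul_B (g : G) {x : Alg σ} (hx : x ∈ B σ) :
    ∃ y ∈ B σ, of σ g * x = y * of σ g := by
  induction hx using Algebra.adjoin_induction with
  | mem x hx =>
    obtain ⟨h, rfl⟩ := hx
    exact ⟨_, e_mem σ (g * h), of_mul_e σ g h⟩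
  | algebraMap r => exact ⟨_, (B σ).algebraMap_mem r, (Algebra.commutes r _).symm⟩
  | add x y _ _ hx hy =>
    obtain ⟨x', hx', h1⟩ := hx
    obtain ⟨y', hy', h2⟩ := hy
    exact ⟨_, (B σ).add_mem hx' hy', by rw [mul_add, add_mul, h1, h2]⟩
  | mul x y _ _ hx hy =>
    obtain ⟨x', hx', h1⟩ := hx
    obtain ⟨y', hy', h2⟩ := hy
    exact ⟨_, (B σ).mul_mem hx' hy', by rw [← mul_assoc, h1, mul_assoc, h2, mul_assoc]⟩

lemma sigma_comm_smul (g : G) (x : Alg σ) :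
    (σ g⁻¹ g)⁻¹ • (of σ g * x * of σ g⁻¹) = (σ g g⁻¹)⁻¹ • (of σ g * x * of σ g⁻¹) := by
  by_cases H : of σ g = 0
  · simp [H]
  · congr 2
    have h1 := of_mul_right σ g g⁻¹
    have h2 := of_mul_left σ g⁻¹ g
    simp only [inv_inv, mul_inv_cancel, inv_mul_cancel, of_one, one_mul, mul_one] at h1 h2
    exact smul_left_injective κ H (h2.symm.trans h1)

lemma theta_mem (g : G) {x : Alg σ} (hx : x ∈ B σ) :
    (σ g⁻¹ g)⁻¹ • (of σ g * x * of σ g⁻¹) ∈ B σ := by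
  obtain ⟨y, hy, h⟩ := of_mul_B σ g hx
  rw [sigma_comm_smul, h, mul_assoc, ← mul_smul_comm]
  exact (B σ).mul_mem hy (e_mem σ g)

end Basic

/-- The map `θ_g^σ(w) = σ(g⁻¹,g)⁻¹ [g] w [g⁻¹]` on `B^σ` (if `σ(g,g⁻¹) = 0` then `[g] = 0` and
`θ_g^σ = 0`). Its restriction `e_{g⁻¹} B^σ → e_g B^σ` is the `g`-th isomorphism of the canonical
partial action of `G` on `B^σ`. -/
def theta (σ : G → G → κ) (g : G) (x : B σ) : B σ :=
  ⟨(σ g⁻¹ g)⁻¹ • (of σ g * (x : Alg σ) * of σ g⁻¹), theta_mem σ g x.2⟩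

/-- `Θ_g(w) = θ_g(e_{g⁻¹} w)`. -/
def Theta (σ : G → G → κ) (g : G) (x : B σ) : B σ := theta σ g (eB σ g⁻¹ * x)

section Theta

variable (σ : G → G → κ)

lemma coe_Theta (g : G) (x : B σ) :
    (Theta σ g x : Alg σ) = (σ g g⁻¹)⁻¹ • (of σ g * (x : Alg σ) * of σ g⁻¹) := by
  rw [← sigma_comm_smul]
  change (σ g⁻¹ g)⁻¹ • (of σ g * (e σ g⁻¹ * (x : Alg σ)) * of σ g⁻¹) = _
  rw [← mul_assoc (of σ g), of_mul_e_inv]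

lemma Theta_add (g : G) (x y : B σ) : Theta σ g (x + y) = Theta σ g x + Theta σ g y := by
  apply Subtype.ext
  simp [coe_Theta, mul_add, add_mul]

lemma Theta_smul (g : G) (r : κ) (x : B σ) : Theta σ g (r • x) = r • Theta σ g x := by
  apply Subtype.ext
  simp [coe_Theta, smul_comm r]

lemma eB_idem (g : G) : eB σ g * eB σ g = eB σ g := by
  apply Subtype.ext
  change e σ g * e σ g = e σ g
  nth_rewrite 2 3 [e]
  rw [mul_smul_comm, ← mul_assoc, e_mul_of]

lemma Theta_eB (g h : G) : Theta σ g (eB σ h) = eB σ g * eB σ (g * h) := by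
  apply Subtype.ext
  rw [coe_Theta]
  change _ = e σ g * e σ (g * h)
  change (σ g g⁻¹)⁻¹ • (of σ g * e σ h * of σ g⁻¹) = _
  rw [of_mul_e, mul_assoc, ← mul_smul_comm, e_comm]
  rfl

lemma eB_one : eB σ 1 = 1 := Subtype.ext (e_one σ)

lemma Theta_one (g : G) : Theta σ g 1 = eB σ g := by
  rw [← eB_one, Theta_eB, mul_one, eB_idem]

lemma Theta_mul (g : G) (x y : B σ) : Theta σ g (x * y) = Theta σ g x * Theta σ g y := by
  apply Subtype.ext
  change (Theta σ g (x * y) : Alg σ) = (Theta σ g x : Alg σ) * (Theta σ g y : Alg σ)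
  rw [coe_Theta, coe_Theta, coe_Theta]
  obtain ⟨x', hx', h1⟩ := of_mul_B σ g x.2
  obtain ⟨y', hy', h2⟩ := of_mul_B σ g y.2
  have h3 : of σ g * ((x * y : B σ) : Alg σ) = x' * y' * of σ g := by
    change of σ g * ((x : Alg σ) * (y : Alg σ)) = _
    rw [← mul_assoc, h1, mul_assoc, h2, mul_assoc]
  have key : ∀ z : Alg σ, (σ g g⁻¹)⁻¹ • (z * of σ g * of σ g⁻¹) = z * e σ g := fun z => by
    rw [mul_assoc, ← mul_smul_comm]
    rfl
  rw [h1, h2, h3, key, key, key]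
  have h4 : e σ g * e σ g = e σ g := congrArg Subtype.val (eB_idem σ g)
  rw [mul_assoc x' (e σ g), ← mul_assoc (e σ g), B_comm σ (e_mem σ g) hy', mul_assoc y', h4,
    mul_assoc]

lemma Theta_zero (g : G) : Theta σ g 0 = 0 := by
  apply Subtype.ext
  simp [coe_Theta]

lemma Theta_id (x : B σ) : Theta σ 1 x = x := by
  apply Subtype.ext
  rw [coe_Theta, ← sigma_comm_smul]
  have h : (σ 1 1⁻¹)⁻¹ • (1 : Alg σ) = 1 := by
    simpa [e, of_one] using e_one σ
  rw [sigma_comm_smul]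
  simp only [of_one, inv_one, one_mul, mul_one] at h ⊢
  rw [← one_mul (x : Alg σ), ← smul_mul_assoc, h]

lemma Theta_comp (g h : G) (x : B σ) :
    Theta σ g (Theta σ h x) = eB σ g * Theta σ (g * h) x := by
  obtain ⟨x, hx⟩ := x
  change x ∈ Algebra.adjoin κ _ at hx
  induction hx using Algebra.adjoin_induction with
  | mem x hx =>
    obtain ⟨k, rfl⟩ := hx
    change Theta σ g (Theta σ h (eB σ k)) = eB σ g * Theta σ (g * h) (eB σ k)
    rw [Theta_eB, Theta_mul, Theta_eB, Theta_eB, Theta_eB, mul_assoc g h k,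
      mul_mul_mul_comm, eB_idem]
  | algebraMap r =>
    have h1 : (⟨algebraMap κ (Alg σ) r, (B σ).algebraMap_mem r⟩ : B σ) = r • 1 := by
      apply Subtype.ext
      simp [Algebra.algebraMap_eq_smul_one]
    change Theta σ g (Theta σ h ⟨algebraMap κ (Alg σ) r, (B σ).algebraMap_mem r⟩)
      = eB σ g * Theta σ (g * h) ⟨algebraMap κ (Alg σ) r, (B σ).algebraMap_mem r⟩
    rw [h1, Theta_smul, Theta_smul, Theta_smul, Theta_one, Theta_one, Theta_eB, mul_smul_comm]
  | add x y hx hy h1 h2 =>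
    have h3 : (⟨x + y, (B σ).add_mem hx hy⟩ : B σ) = ⟨x, hx⟩ + ⟨y, hy⟩ := rfl
    change Theta σ g (Theta σ h ⟨x + y, (B σ).add_mem hx hy⟩)
      = eB σ g * Theta σ (g * h) ⟨x + y, (B σ).add_mem hx hy⟩
    rw [h3, Theta_add, Theta_add, Theta_add, mul_add]
    exact congrArg₂ (· + ·) h1 h2
  | mul x y hx hy h1 h2 =>
    have h3 : (⟨x * y, (B σ).mul_mem hx hy⟩ : B σ) = ⟨x, hx⟩ * ⟨y, hy⟩ := rfl
    change Theta σ g (Theta σ h ⟨x * y, (B σ).mul_mem hx hy⟩)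
      = eB σ g * Theta σ (g * h) ⟨x * y, (B σ).mul_mem hx hy⟩
    rw [h3, Theta_mul, Theta_mul, Theta_mul]
    refine (congrArg₂ (· * ·) h1 h2).trans ?_
    change eB σ g * _ * (eB σ g * _) = _
    rw [mul_mul_mul_comm, eB_idem]

end Theta

end TwistedPartial

/-- A topological partial action of a group `G` on a topological space `X`: open sets `X_g` and
homeomorphisms `θ_g : X_{g⁻¹} → X_g`, the latter encoded as open partial homeomorphisms of `X`
with source `X_{g⁻¹}` and target `X_g`. -/
structure TopologicalPartialAction (G : Type v) [Group G] (X : Type w) [TopologicalSpace X] where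
  dom : G → Set X
  act : G → OpenPartialHomeomorph X X
  source_eq : ∀ g, (act g).source = dom g⁻¹
  target_eq : ∀ g, (act g).target = dom g
  dom_one : dom 1 = Set.univ
  act_one : ∀ x, act 1 x = x
  image_dom : ∀ g h, act g '' (dom g⁻¹ ∩ dom h) = dom g ∩ dom (g * h)
  act_act : ∀ g h, ∀ x ∈ dom h⁻¹ ∩ dom (g * h)⁻¹, act g (act h x) = act (g * h) x

/-- Topological freeness: for `g ≠ 1` the fixed-point set of `θ_g` has empty interior. -/
def TopologicalPartialAction.IsTopologicallyFree {G : Type v} [Group G] {X : Type w}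
    [TopologicalSpace X] (θ : TopologicalPartialAction G X) : Prop :=
  ∀ g : G, g ≠ 1 → interior {x | x ∈ θ.dom g⁻¹ ∧ θ.act g x = x} = ∅

namespace TwistedPartial

variable {κ : Type u} {G : Type v} [Field κ] [Group G] (σ : G → G → κ)

/-- `D̂_g = D(e_g)`, a subset of `Spec B^σ`. -/
def specDom (g : G) : Set (PrimeSpectrum (B σ)) := {p | eB σ g ∉ p.asIdeal}

/-- The prime ideal `θ̂_g(p) = {w | Θ_{g⁻¹}(w) ∈ p}`, for `p ∈ D̂_{g⁻¹}`. When `p` is the kernel of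
a homomorphism `f : B^σ → κ` this is the kernel of `f ∘ Θ_{g⁻¹}`. -/
def specMapOn (g : G) (p : PrimeSpectrum (B σ)) (hp : p ∈ specDom σ g⁻¹) :
    PrimeSpectrum (B σ) where
  asIdeal :=
    { carrier := {x | Theta σ g⁻¹ x ∈ p.asIdeal}
      zero_mem' := by
        rw [Set.mem_ofPred_eq, Theta_zero]
        exact p.asIdeal.zero_mem
      add_mem' := fun {a b} ha hb => by
        rw [Set.mem_ofPred_eq, Theta_add]
        exact p.asIdeal.add_mem ha hb
      smul_mem' := fun c x hx => by
        rw [Set.mem_ofPred_eq, smul_eq_mul, Theta_mul]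
        exact p.asIdeal.mul_mem_left _ hx }
  isPrime :=
    { ne_top' := fun h => hp (by
        have h1 : (1 : B σ) ∈ (⊤ : Ideal (B σ)) := trivial
        rw [← h] at h1
        have h2 : Theta σ g⁻¹ 1 ∈ p.asIdeal := h1
        rwa [Theta_one] at h2)
      mem_or_mem' := fun {x y} h => by
        have h2 : Theta σ g⁻¹ (x * y) ∈ p.asIdeal := h
        rw [Theta_mul] at h2
        exact p.isPrime.mem_or_mem h2 }

open Classical in
/-- `θ̂_g` on `D̂_{g⁻¹}`, extended by the identity to a total function. -/
noncomputable def specMap (g : G) (p : PrimeSpectrum (B σ)) : PrimeSpectrum (B σ) :=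
  if hp : p ∈ specDom σ g⁻¹ then specMapOn σ g p hp else p

lemma mem_specMap {g : G} {p : PrimeSpectrum (B σ)} (hp : p ∈ specDom σ g⁻¹) (x : B σ) :
    x ∈ (specMap σ g p).asIdeal ↔ Theta σ g⁻¹ x ∈ p.asIdeal := by
  rw [specMap, dif_pos hp]
  rfl

lemma specDom_one : specDom σ (1 : G) = Set.univ := by
  refine Set.eq_univ_of_forall fun p h => ?_
  rw [eB_one] at h
  exact p.isPrime.ne_top ((Ideal.eq_top_iff_one _).2 h)

lemma specMap_mem_iff {g : G} {p : PrimeSpectrum (B σ)} (hp : p ∈ specDom σ g⁻¹) (h : G) :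
    specMap σ g p ∈ specDom σ h ↔ p ∈ specDom σ (g⁻¹ * h) := by
  change ¬ _ ↔ ¬ _
  rw [mem_specMap σ hp, Theta_eB, p.isPrime.mul_mem_iff_mem_or_mem]
  have : eB σ g⁻¹ ∉ p.asIdeal := hp
  tauto

lemma specMap_maps {g : G} {p : PrimeSpectrum (B σ)} (hp : p ∈ specDom σ g⁻¹) :
    specMap σ g p ∈ specDom σ g := by
  rw [specMap_mem_iff σ hp, inv_mul_cancel, specDom_one]
  trivial

lemma specMap_specMap {g h : G} {p : PrimeSpectrum (B σ)} (h1 : p ∈ specDom σ h⁻¹)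
    (h2 : p ∈ specDom σ (g * h)⁻¹) :
    specMap σ g (specMap σ h p) = specMap σ (g * h) p := by
  have h3 : specMap σ h p ∈ specDom σ g⁻¹ := by
    rw [specMap_mem_iff σ h1, ← mul_inv_rev]
    exact h2
  refine PrimeSpectrum.ext (Ideal.ext fun x => ?_)
  rw [mem_specMap σ h3, mem_specMap σ h1, mem_specMap σ h2, Theta_comp, ← mul_inv_rev,
    p.isPrime.mul_mem_iff_mem_or_mem]
  have : eB σ h⁻¹ ∉ p.asIdeal := h1
  tauto

lemma specMap_one (p : PrimeSpectrum (B σ)) : specMap σ 1 p = p := by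
  refine PrimeSpectrum.ext (Ideal.ext fun x => ?_)
  have hp : p ∈ specDom σ (1 : G)⁻¹ := by
    rw [inv_one, specDom_one]
    trivial
  rw [mem_specMap σ hp, inv_one, Theta_id]

lemma specMap_inv {g : G} {p : PrimeSpectrum (B σ)} (hp : p ∈ specDom σ g⁻¹) :
    specMap σ g⁻¹ (specMap σ g p) = p := by
  rw [specMap_specMap σ hp (by rw [inv_mul_cancel, inv_one, specDom_one]; trivial),
    inv_mul_cancel, specMap_one]

lemma isOpen_specDom (g : G) : IsOpen (specDom σ g) :=
  (PrimeSpectrum.basicOpen (eB σ g)).isOpen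

lemma continuousOn_specMap (g : G) : ContinuousOn (specMap σ g) (specDom σ g⁻¹) := by
  rw [continuousOn_iff_continuous_domRestrict,
    PrimeSpectrum.isTopologicalBasis_basic_opens.continuous_iff]
  rintro _ ⟨a, rfl⟩
  refine ⟨(PrimeSpectrum.basicOpen (Theta σ g⁻¹ a) : Set (PrimeSpectrum (B σ))),
    (PrimeSpectrum.basicOpen _).isOpen, ?_⟩
  ext p
  exact not_congr (mem_specMap σ p.2 a).symm

/-- `θ̂_g : D̂_{g⁻¹} → D̂_g`. -/
noncomputable def specHomeo (g : G) :
    OpenPartialHomeomorph (PrimeSpectrum (B σ)) (PrimeSpectrum (B σ)) where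
  toFun := specMap σ g
  invFun := specMap σ g⁻¹
  source := specDom σ g⁻¹
  target := specDom σ g
  map_source' := fun _ hp => specMap_maps σ hp
  map_target' := fun p hp => specMap_maps σ (by rwa [inv_inv])
  left_inv' := fun _ hp => specMap_inv σ hp
  right_inv' := fun p hp => by
    have h : p ∈ specDom σ g⁻¹⁻¹ := by rwa [inv_inv]
    simpa using specMap_inv σ h
  open_source := isOpen_specDom σ _
  open_target := isOpen_specDom σ _
  continuousOn_toFun := continuousOn_specMap σ g
  continuousOn_invFun := by simpa using continuousOn_specMap σ g⁻¹

/-- The spectral partial action `θ̂` of `G` on `Spec B^σ`. -/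
noncomputable def spectralPartialAction :
    TopologicalPartialAction G (PrimeSpectrum (B σ)) where
  dom := specDom σ
  act := specHomeo σ
  source_eq := fun _ => rfl
  target_eq := fun _ => rfl
  dom_one := specDom_one σ
  act_one := specMap_one σ
  image_dom := fun g h => by
    change specMap σ g '' _ = _
    ext q
    constructor
    · rintro ⟨p, ⟨h1, h2⟩, rfl⟩
      refine ⟨specMap_maps σ h1, (specMap_mem_iff σ h1 _).2 ?_⟩
      rwa [inv_mul_cancel_left]
    · rintro ⟨h1, h2⟩
      have h1' : q ∈ specDom σ g⁻¹⁻¹ := by rwa [inv_inv]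
      refine ⟨specMap σ g⁻¹ q, ⟨specMap_maps σ h1', (specMap_mem_iff σ h1' _).2 ?_⟩, ?_⟩
      · rwa [inv_inv]
      · simpa using specMap_inv σ h1'
  act_act := fun _ _ _ hx => specMap_specMap σ hx.1 hx.2

end TwistedPartial

/-! The coaction `[g] ↦ [g] ⊗ g` grades `κ_par^σ G` by `G`, with degree-`g` part `B^σ [g]` and
degree-`1` part `B^σ`; moreover `[g] b = Θ_g(b) [g]`. Topological freeness enters only through
`eq_zero_of_mul_Theta_eq`: for `g ≠ 1`, only `w = 0` in `B^σ` satisfies `w Θ_g(b) = w b` for all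
`b`, because every prime in the basic open set of such a `w` is fixed by `θ̂_{g⁻¹}`, and `B^σ` is
reduced.

If `a` commutes with `B^σ` and has degree-`g` part `c [g]`, comparing components shows that `w = c
e_g` is such an element, so `c [g] = 0`: `B^σ` is its own centralizer, hence maximal commutative.
For a nonzero element of an ideal, translate a nonzero component to degree `1`, then remove the
components of other degrees one at a time by passing from `a` to `Θ_g(b) a - a b`, with `b` chosen
to keep degree `1` nonzero. -/

/-- A commutative algebra over a field that is generated by idempotents is reduced. -/
lemma isReduced_of_adjoin_idempotents {k : Type*} {R : Type*} [Field k] [CommRing R] [Algebra k R]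
    {s : Set R} (hs : ∀ x ∈ s, IsIdempotentElem x) (htop : Algebra.adjoin k s = ⊤) :
    IsReduced R := by
  -- The idempotent `u` and the constant `c` make the induction work: adding `r • f` to `y` changes
  -- `c` to `c + r` on the piece cut out by `f` and changes nothing on the piece cut out by `1 - f`.
  let P : R → Prop := fun y => ∀ (u : R) (c : k), IsIdempotentElem u →
    IsNilpotent (u * (y + algebraMap k R c)) → u * (y + algebraMap k R c) = 0
  have hP0 : P 0 := by
    intro u c hu hn
    by_cases hc : c = 0
    · simp [hc]
    · have h1 : IsNilpotent u := by
        have h2 := (Commute.all (u * (0 + algebraMap k R c)) (algebraMap k R c⁻¹)).isNilpotent_mul_right hn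
        rwa [zero_add, mul_assoc, ← map_mul, mul_inv_cancel₀ hc, map_one, mul_one] at h2
      obtain ⟨n, hn⟩ := h1
      have h3 : u ^ (n + 1) = 0 := by rw [pow_succ, hn, zero_mul]
      rw [hu.pow_succ_eq] at h3
      rw [h3, zero_mul]
  have hclosure : ∀ x ∈ Submonoid.closure s, IsIdempotentElem x := by
    intro x hx
    induction hx using Submonoid.closure_induction with
    | mem x hx => exact hs x hx
    | one => exact IsIdempotentElem.one
    | mul x y _ _ hx hy => exact hx.mul hy
  -- `P` is not visibly additive; "adding a multiple of `x` preserves `P`" is closed under sums and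
  -- scalars, as span induction requires.
  have hadd : ∀ x : R, ∀ (r : k) (y : R), P y → P (r • x + y) := by
    intro x
    have hx : x ∈ Submodule.span k (Submonoid.closure s : Set R) := by
      rw [← Algebra.adjoin_eq_span, htop]
      trivial
    induction hx using Submodule.span_induction with
    | mem f hf =>
      have hf' := hclosure f hf
      intro r y hy u c hu hn
      have e1 : u * f * (y + algebraMap k R (c + r)) =
          f * (u * (r • f + y + algebraMap k R c)) := by
        rw [map_add, Algebra.smul_def]
        linear_combination (-algebraMap k R r * u) * hf'.eq
      have e2 : u * (1 - f) * (y + algebraMap k R c) =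
          (1 - f) * (u * (r • f + y + algebraMap k R c)) := by
        rw [Algebra.smul_def]
        linear_combination (algebraMap k R r * u) * hf'.eq
      have h1 := hy (u * f) (c + r) (hu.mul hf')
        (e1 ▸ (Commute.all _ _).isNilpotent_mul_left hn)
      have h2 := hy (u * (1 - f)) c (hu.mul hf'.one_sub)
        (e2 ▸ (Commute.all _ _).isNilpotent_mul_left hn)
      rw [e1] at h1
      rw [e2] at h2
      linear_combination h1 + h2
    | zero => intro r y hy; simpa using hy
    | add x x' _ _ hx hx' => intro r y hy; simpa [add_assoc] using hx r _ (hx' r y hy)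
    | smul a x _ hx => intro r y hy; simpa [smul_smul] using hx (r * a) y hy
  refine ⟨fun x hx => ?_⟩
  simpa using hadd x 1 0 hP0 1 0 IsIdempotentElem.one (by simpa using hx)

namespace TwistedPartial

variable {κ : Type u} {G : Type v} [Field κ] [Group G] (σ : G → G → κ)

/-! ### Reducedness of `B^σ` and the use of topological freeness -/

lemma isReduced_B : IsReduced (B σ) := by
  refine isReduced_of_adjoin_idempotents (k := κ) (s := Set.range (eB σ)) ?_ ?_
  · rintro _ ⟨g, rfl⟩
    exact eB_idem σ g
  · rw [show Set.range (eB σ) = Subtype.val ⁻¹' Set.range (e σ) from ?_]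
    · exact Algebra.adjoin_adjoin_coe_preimage
    ext x
    exact ⟨fun ⟨g, hg⟩ => ⟨g, hg ▸ rfl⟩, fun ⟨g, hg⟩ => ⟨g, Subtype.ext hg⟩⟩

variable {σ} in
-- At a prime `p` not containing `w`, cancelling `w` gives `Θ_g(b) ∈ p ↔ b ∈ p`. Taking `b = 1`
-- shows `e_g ∉ p`, and the equivalence then says that `θ̂_{g⁻¹}`, which is pullback along `Θ_g`,
-- fixes `p`. So the basic open set of `w` lies in a set with empty interior, and `w` is nilpotent.
lemma eq_zero_of_mul_Theta_eq
    (hfree : (spectralPartialAction σ).IsTopologicallyFree) {g : G} (hg : g ≠ 1) {w : B σ}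
    (hw : ∀ b, w * Theta σ g b = w * b) : w = 0 := by
  have := isReduced_B σ
  refine IsNilpotent.eq_zero (PrimeSpectrum.basicOpen_eq_bot_iff w |>.1 ?_)
  rw [eq_bot_iff, ← SetLike.coe_subset_coe]
  have hint := hfree g⁻¹ (inv_ne_one.2 hg)
  refine (interior_maximal ?_ (PrimeSpectrum.basicOpen w).isOpen).trans hint.subset
  intro p hp
  have hp' : w ∉ p.asIdeal := hp
  have hiff : ∀ b, Theta σ g b ∈ p.asIdeal ↔ b ∈ p.asIdeal := by
    intro b
    have h1 := p.isPrime.mul_mem_iff_mem_or_mem (x := w) (y := b)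
    rw [← hw b, p.isPrime.mul_mem_iff_mem_or_mem] at h1
    tauto
  have hdom : p ∈ specDom σ g⁻¹⁻¹ := by
    rw [inv_inv]
    change eB σ g ∉ p.asIdeal
    rw [← Theta_one, hiff]
    exact (Ideal.ne_top_iff_one _).1 p.isPrime.ne_top
  refine ⟨hdom, PrimeSpectrum.ext (Ideal.ext fun b => ?_)⟩
  change b ∈ (specMap σ g⁻¹ p).asIdeal ↔ _
  rw [mem_specMap σ hdom, inv_inv, hiff]

/-! ### The `G`-grading and its homogeneous components -/

/-- `[g] b = Θ_g(b) [g]`. -/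
lemma of_mul_coe (g : G) (b : B σ) :
    of σ g * (b : Alg σ) = (Theta σ g b : Alg σ) * of σ g := by
  obtain ⟨y, hy, h⟩ := of_mul_B σ g b.2
  have h1 : (Theta σ g b : Alg σ) = y * e σ g := by
    rw [coe_Theta, h, mul_assoc, ← mul_smul_comm]
    rfl
  rw [h1, mul_assoc, e_mul_of, h]

/-- If `b [g] = 0` with `b ∈ B^σ`, then `b e_g = 0`. -/
lemma mul_e_eq_zero {g : G} {x : Alg σ} (h : x * of σ g = 0) : x * e σ g = 0 := by
  rw [e, mul_smul_comm, ← mul_assoc, h, zero_mul, smul_zero]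

/-- The `G`-grading of the twisted partial group algebra, as the coaction `[g] ↦ [g] ⊗ g`. -/
noncomputable def coaction : Alg σ →ₐ[κ] MonoidAlgebra (Alg σ) G :=
  RingQuot.liftAlgHom κ ⟨FreeAlgebra.lift κ (fun g => MonoidAlgebra.single g (of σ g)), by
    intro x y h
    cases h with
    | zero_left g h H => simp [of_zero_left σ H]
    | zero_right g h H => simp [of_zero_right σ H]
    | mul_left g h => simp [of_mul_left, MonoidAlgebra.smul_single]
    | mul_right g h => simp [of_mul_right, MonoidAlgebra.smul_single]
    | map_one => simp [of_one, MonoidAlgebra.one_def]⟩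

lemma coaction_of (g : G) : coaction σ (of σ g) = MonoidAlgebra.single g (of σ g) := by
  rw [coaction, of, RingQuot.liftAlgHom_mkAlgHom_apply, FreeAlgebra.lift_ι_apply]
  rfl

lemma coaction_of_mem_B {b : Alg σ} (hb : b ∈ B σ) :
    coaction σ b = MonoidAlgebra.single 1 b := by
  induction hb using Algebra.adjoin_induction with
  | mem x hx =>
    obtain ⟨g, rfl⟩ := hx
    simp [e, coaction_of, MonoidAlgebra.smul_single]
  | algebraMap r => rw [AlgHom.commutes]; rfl
  | add x y _ _ hx hy => rw [map_add, hx, hy, MonoidAlgebra.single_add]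
  | mul x y _ _ hx hy => rw [map_mul, hx, hy, MonoidAlgebra.single_mul_single, one_mul]

/-- Writing `[g] = e_g [g]` exposes a factor `[g⁻¹][g][h]`, to which relation (iv) applies. This
brings words in the generators into the form `b [k]` with `b ∈ B^σ`. -/
lemma of_mul_of (g h : G) : of σ g * of σ h = σ g h • (e σ g * of σ (g * h)) := by
  rw [← e_mul_of, e]
  simp only [smul_mul_assoc]
  rw [mul_assoc, mul_assoc, ← mul_assoc (of σ g⁻¹), of_mul_left, mul_smul_comm, smul_comm,
    mul_assoc]

/-- Every element is a linear combination of the `b [g]` with `b ∈ B^σ`. -/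
lemma mem_span_mul_of (a : Alg σ) :
    a ∈ Submodule.span κ {x | ∃ b ∈ B σ, ∃ g, x = b * of σ g} := by
  set M := Submodule.span κ {x | ∃ b ∈ B σ, ∃ g, x = b * of σ g} with hM
  -- `M` is a left ideal; since it contains `1`, it is everything.
  have hmul : ∀ x : FreeAlgebra κ G, ∀ m ∈ M, RingQuot.mkAlgHom κ (Rel σ) x * m ∈ M := by
    intro x
    induction x using FreeAlgebra.induction with
    | grade0 r =>
      intro m hm
      rw [AlgHom.commutes, ← Algebra.smul_def]
      exact M.smul_mem r hm
    | grade1 h =>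
      intro m hm
      induction hm using Submodule.span_induction with
      | mem m hm =>
        obtain ⟨b, hb, g, rfl⟩ := hm
        obtain ⟨b', hb', h1⟩ := of_mul_B σ h hb
        refine Submodule.subset_span ⟨b' * (σ h g • e σ h),
          (B σ).mul_mem hb' ((B σ).smul_mem (e_mem σ h) _), h * g, ?_⟩
        change of σ h * _ = _
        rw [← mul_assoc, h1, mul_assoc, of_mul_of, mul_assoc, smul_mul_assoc]
      | zero => simp
      | add x y _ _ hx hy => rw [mul_add]; exact M.add_mem hx hy
      | smul r x _ hx => rw [mul_smul_comm]; exact M.smul_mem r hx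
    | mul x y hx hy => intro m hm; rw [map_mul, mul_assoc]; exact hx _ (hy m hm)
    | add x y hx hy => intro m hm; rw [map_add, add_mul]; exact M.add_mem (hx m hm) (hy m hm)
  obtain ⟨x, rfl⟩ := RingQuot.mkAlgHom_surjective κ (Rel σ) a
  rw [← mul_one (RingQuot.mkAlgHom κ (Rel σ) x)]
  exact hmul x 1 (Submodule.subset_span ⟨1, (B σ).one_mem, 1, by rw [of_one, mul_one]⟩)

lemma coaction_mul_of {b : Alg σ} (hb : b ∈ B σ) (g : G) :
    coaction σ (b * of σ g) = MonoidAlgebra.single g (b * of σ g) := by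
  rw [map_mul, coaction_of_mem_B σ hb, coaction_of, MonoidAlgebra.single_mul_single, one_mul]

/-- The homogeneous component of degree `g` lies in `B^σ [g]`. -/
lemma exists_coeff_coaction (a : Alg σ) (g : G) :
    ∃ b : B σ, (coaction σ a).coeff g = (b : Alg σ) * of σ g := by
  classical
  induction mem_span_mul_of σ a using Submodule.span_induction with
  | mem x hx =>
    obtain ⟨b, hb, h, rfl⟩ := hx
    rw [coaction_mul_of σ hb, MonoidAlgebra.coeff_single, Finsupp.single_apply]
    split_ifs with heq
    · exact ⟨⟨b, hb⟩, by rw [heq]⟩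
    · exact ⟨0, by simp⟩
  | zero => exact ⟨0, by simp⟩
  | add x y _ _ hx hy =>
    obtain ⟨b, hb⟩ := hx
    obtain ⟨c, hc⟩ := hy
    exact ⟨b + c, by
      rw [map_add, MonoidAlgebra.coeff_add, Finsupp.add_apply, hb, hc, ← add_mul]; rfl⟩
  | smul r x _ hx =>
    obtain ⟨b, hb⟩ := hx
    exact ⟨r • b, by
      rw [map_smul, MonoidAlgebra.coeff_smul_apply, hb, ← smul_mul_assoc]; rfl⟩

/-- An element is the sum of its homogeneous components. -/
lemma sum_coaction (a : Alg σ) : (coaction σ a).coeff.sum (fun _ x => x) = a := by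
  induction mem_span_mul_of σ a using Submodule.span_induction with
  | mem x hx =>
    obtain ⟨b, hb, h, rfl⟩ := hx
    rw [coaction_mul_of σ hb, MonoidAlgebra.coeff_single, Finsupp.sum_single_index rfl]
  | zero => simp
  | add x y _ _ hx hy =>
    rw [map_add, MonoidAlgebra.coeff_add, Finsupp.sum_add_index' (fun _ => rfl)
      (fun _ _ _ => rfl), hx, hy]
  | smul r x _ hx =>
    rw [map_smul, MonoidAlgebra.coeff_smul, Finsupp.sum_smul_index' (fun _ => rfl),
      ← Finsupp.smul_sum, hx]

lemma mem_B_of_coeff_eq_zero {a : Alg σ} (h : ∀ g ≠ 1, (coaction σ a).coeff g = 0) :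
    a ∈ B σ := by
  rw [← sum_coaction σ a]
  refine (B σ).sum_mem fun g _ => ?_
  by_cases hg : g = 1
  · obtain ⟨b, hb⟩ := exists_coeff_coaction σ a g
    rw [hb, hg, of_one, mul_one]
    exact b.2
  · rw [h g hg]
    exact (B σ).zero_mem

lemma coeff_coaction_mul_B (a : Alg σ) (b : B σ) (g : G) :
    (coaction σ (a * b)).coeff g = (coaction σ a).coeff g * b := by
  rw [map_mul, coaction_of_mem_B σ b.2, MonoidAlgebra.coeff_mul_single_one]

lemma coeff_coaction_B_mul (a : Alg σ) (b : B σ) (g : G) :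
    (coaction σ (b * a)).coeff g = b * (coaction σ a).coeff g := by
  rw [map_mul, coaction_of_mem_B σ b.2, MonoidAlgebra.coeff_single_one_mul]

variable {σ}

/-! ### Centralizer of `B^σ` and ideal intersection -/

/-- If `θ̂` is topologically free, then `B^σ` is its own centralizer. -/
lemma mem_B_of_commute (hfree : (spectralPartialAction σ).IsTopologicallyFree) {a : Alg σ}
    (ha : ∀ b : B σ, a * b = b * a) : a ∈ B σ := by
  refine mem_B_of_coeff_eq_zero σ fun g hg => ?_
  obtain ⟨c, hc⟩ := exists_coeff_coaction σ a g
  -- The component `c [g]` determines `c` only after multiplication by `e_g`, so the test element is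
  -- `c e_g` rather than `c`.
  have hw : c * eB σ g = 0 := by
    refine eq_zero_of_mul_Theta_eq hfree hg fun b => ?_
    have h1 := congrArg (fun x => (coaction σ x).coeff g) (ha b)
    simp only [coeff_coaction_mul_B, coeff_coaction_B_mul, hc] at h1
    rw [mul_assoc, of_mul_coe, ← mul_assoc, ← mul_assoc, ← sub_eq_zero, ← sub_mul] at h1
    have h2 : (c * Theta σ g b - b * c) * eB σ g = 0 := Subtype.ext (mul_e_eq_zero σ h1)
    linear_combination h2
  rw [hc, ← e_mul_of, ← mul_assoc]
  have h3 : (c : Alg σ) * e σ g = 0 := congrArg Subtype.val hw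
  rw [h3, zero_mul]

/-- If `θ̂` is topologically free, then an ideal containing an element whose component of degree
`1` is nonzero meets `B^σ` nontrivially. -/
lemma exists_mem_B_of_coeff_one_ne_zero
    (hfree : (spectralPartialAction σ).IsTopologicallyFree) (I : TwoSidedIdeal (Alg σ))
    (s : Finset G) : ∀ a ∈ I, (coaction σ a).coeff 1 ≠ 0 →
      (∀ g ≠ 1, g ∉ s → (coaction σ a).coeff g = 0) → ∃ x ∈ I, x ∈ B σ ∧ x ≠ 0 := by
  classical
  induction s using Finset.induction with
  | empty =>
    intro a ha h1 h
    exact ⟨a, ha, mem_B_of_coeff_eq_zero σ fun g hg => h g hg (Finset.notMem_empty g),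
      fun h0 => h1 (by simp [h0])⟩
  | insert g s _ ih =>
    intro a ha h1 h
    -- `s` only bounds the support away from degree `1`, so `1` may occur in it and is simply
    -- dropped.
    by_cases hg : g = 1
    · exact ih a ha h1 fun k hk hks => h k hk (by simp [hg, hk, hks])
    · obtain ⟨w, hw⟩ := exists_coeff_coaction σ a 1
      rw [of_one, mul_one] at hw
      have hw0 : w ≠ 0 := fun h0 => h1 (by rw [hw, h0]; rfl)
      obtain ⟨b, hb⟩ : ∃ b, w * Theta σ g b ≠ w * b := by
        by_contra! hcon
        exact hw0 (eq_zero_of_mul_Theta_eq hfree hg hcon)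
      have hcoeff : ∀ k, (coaction σ ((Theta σ g b : Alg σ) * a - a * b)).coeff k =
          (Theta σ g b : Alg σ) * (coaction σ a).coeff k - (coaction σ a).coeff k * b := by
        intro k
        rw [map_sub, MonoidAlgebra.coeff_sub, Finsupp.sub_apply, coeff_coaction_mul_B,
          coeff_coaction_B_mul]
      -- Degree `1` becomes `w (Θ_g(b) - b) ≠ 0`, degree `g` cancels by `[g] b = Θ_g(b) [g]`, and
      -- vanishing components stay zero.
      refine ih ((Theta σ g b : Alg σ) * a - a * b) (I.sub_mem (I.mul_mem_left _ _ ha) (I.mul_mem_right _ _ ha)) ?_ ?_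
      · rw [hcoeff, hw]
        intro h0
        have h2 : Theta σ g b * w - w * b = 0 := Subtype.ext h0
        exact hb (by linear_combination h2)
      · intro k hk hks
        rw [hcoeff]
        by_cases hkg : k = g
        · obtain ⟨c, hc⟩ := exists_coeff_coaction σ a k
          have h3 : (Theta σ g b : Alg σ) * c = c * Theta σ g b :=
            B_comm σ (Theta σ g b).2 c.2
          rw [hc, mul_assoc, of_mul_coe, hkg, ← mul_assoc, ← mul_assoc, h3, sub_self]
        · rw [h k hk (by simp [hkg, hks]), mul_zero, zero_mul, sub_zero]

lemma exists_mem_B_of_ne_zero (hfree : (spectralPartialAction σ).IsTopologicallyFree)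
    (I : TwoSidedIdeal (Alg σ)) {a : Alg σ} (ha : a ∈ I) (ha0 : a ≠ 0) :
    ∃ x ∈ I, x ∈ B σ ∧ x ≠ 0 := by
  obtain ⟨g, hg⟩ : ∃ g, (coaction σ a).coeff g ≠ 0 := by
    by_contra! hcon
    refine ha0 ?_
    rw [← sum_coaction σ a]
    exact Finset.sum_eq_zero fun g _ => hcon g
  -- Right multiplication by `[g⁻¹]` moves degree `g` to degree `1`. It cannot kill `c [g]`, because
  -- `[g] = [g] e_{g⁻¹}` is a scalar multiple of `[g][g⁻¹][g]`.
  refine exists_mem_B_of_coeff_one_ne_zero hfree I _ (a * of σ g⁻¹) (I.mul_mem_right _ _ ha)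
    ?_ fun k _ hk => Finsupp.notMem_support_iff.1 hk
  rw [map_mul, coaction_of, MonoidAlgebra.coeff_mul_single_apply]
  intro h0
  refine hg ?_
  obtain ⟨c, hc⟩ := exists_coeff_coaction σ a g
  simp only [inv_inv, one_mul, hc] at h0
  rw [hc, ← of_mul_e_inv, e, inv_inv, mul_smul_comm, mul_smul_comm, ← mul_assoc, ← mul_assoc,
    h0, zero_mul, smul_zero]

end TwistedPartial

theorem mainTheorem9 {κ : Type u} {G : Type v} [Field κ] [Group G] (σ : G → G → κ)
    (hσ : IsFactorSet.{u, v, w} σ)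
    (hfree : (TwistedPartial.spectralPartialAction σ).IsTopologicallyFree) :
    Maximal (fun S : Subalgebra κ (TwistedPartial.Alg σ) => ∀ x ∈ S, ∀ y ∈ S, x * y = y * x)
        (TwistedPartial.B σ) ∧
      ∀ I : TwoSidedIdeal (TwistedPartial.Alg σ), I ≠ ⊥ →
        ∃ x ∈ I, x ∈ TwistedPartial.B σ ∧ x ≠ 0 := by
  refine ⟨⟨fun x hx y hy => TwistedPartial.B_comm σ hx hy, fun S hS hle a ha => ?_⟩, fun I hI => ?_⟩
  · exact TwistedPartial.mem_B_of_commute hfree fun b => hS a ha b (hle b.2)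
  · obtain ⟨a, ha, ha0⟩ : ∃ a ∈ I, a ≠ 0 := by
      by_contra! hcon
      refine hI (eq_bot_iff.2 fun x hx => ?_)
      rw [hcon x hx]
      exact TwoSidedIdeal.zero_mem _
    exact TwistedPartial.exists_mem_B_of_ne_zero hfree I ha ha0
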